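/- A curve in the plane is the image of a continuous map $\phi:[0,1]\to\mathbb{R}^2$; it is $x$-monotone if every vertical line meets it in at most one point. The disjointness graph of a family $\mathcal{C}$ of curves is the graph with vertex set $\mathcal{C}$ in which two distinct curves are joined by an edge if and only if they are disjoint. Write $\omega(G)$ and $\chi(G)$ for the clique number and the chromatic number of a graph $G$. For every integer $k\ge 2$ there exists a finite family $\mathcal{C}$ of $x$-monotone curves, all of which have nonempty intersection with a common vertical line $l$, such that the disjointness graph $G$ of $\mathcal{C}$ satisfies $$\omega(G)=k\qquad\text{and}\qquad \chi(G)=\frac{k+1}{2}\binom{k+2}{3}.$$ Consequently, there is an absolute constant $c>0$ such that for every integer $k\ge 2$ there is a finite family of $x$-monotone curves whose disjointness graph is $K_{k+1}$-free and has no proper coloring with fewer than $c\,k^4$ colors. -/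

import Mathlib

/-- A curve in the plane: the image of a continuous map `φ : [0,1] → ℝ²`. -/
def IsCurve (C : Set (ℝ × ℝ)) : Prop :=
  ∃ φ : unitInterval → ℝ × ℝ, Continuous φ ∧ Set.range φ = C

/-- The vertical line `{x = a}`. -/
def verticalLine (a : ℝ) : Set (ℝ × ℝ) := {p | p.1 = a}

/-- A set in the plane is x-monotone if every vertical line meets it in at most one point. -/
def IsXMonotone (C : Set (ℝ × ℝ)) : Prop :=
  ∀ a : ℝ, (C ∩ verticalLine a).Subsingleton

/-- The intersection graph of a family of sets: the vertices are the members of the family, and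
two distinct members are joined by an edge if they have a nonempty intersection. -/
def intersectionGraph {X : Type*} (F : Set (Set X)) : SimpleGraph F where
  Adj C D := C ≠ D ∧ ((C : Set X) ∩ (D : Set X)).Nonempty
  symm := ⟨fun _ _ h => ⟨h.1.symm, by rw [Set.inter_comm]; exact h.2⟩⟩
  loopless := ⟨fun _ h => h.1 rfl⟩

/-- The disjointness graph of a family of sets: the complement of its intersection graph. -/
def disjointnessGraph {X : Type*} (F : Set (Set X)) : SimpleGraph F :=
  (intersectionGraph F)ᶜ

/-- Two distinct members of the family are joined in the disjointness graph iff they are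
disjoint. -/
theorem disjointnessGraph_adj {X : Type*} (F : Set (Set X)) (C D : F) :
    (disjointnessGraph F).Adj C D ↔ C ≠ D ∧ Disjoint (C : Set X) (D : Set X) := by
  simp only [disjointnessGraph, intersectionGraph, SimpleGraph.compl_adj,
    Set.disjoint_iff_inter_eq_empty, ← Set.not_nonempty_iff_eq_empty]
  tauto

/-! Disjointness is encoded by directed paths. Take a finite acyclic digraph and give each vertex
one weight per side of the line. Curves of larger weight extend further on that side, and two curves
are made to avoid each other there exactly when a directed path joins them without dipping below the
smaller end weight (`exists_oneSided`, `exists_curves`). On a Zykov-type digraph (`exists_zykov`)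
all walks between two vertices pass through the same vertices, so of three clique members in path
order the middle one is never lighter than both others, in either weight. An arc has no interior
vertex, so it stays an edge and all N colours are needed; they suffice because colours increase
along edges.

The weights depend on the colour only. It remains to order N colours and weight them so that a
valley-free set has at most k members. The colours are the quadruples (a, d, b, c) with b, c < k - a
- d, in lexicographic order with d reversed. If the first difference is in a, both weights rise; in
d, both fall; in b, the left one rises and the right one falls; in c, the opposite. A valley-free
set has at most a + d + (k - a - d) members for suitable a and d (`card_le_of_valleyFree`), while
there are ∑ (k - a - d)² = k(k+1)²(k+2)/12 quadruples. The quadruples (t, 0, 0, 0) yield a clique of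
size k. -/

open Relation

/-! ### Directed paths of high weight -/

/-- The relation `A` with both ends confined to `X`. -/
def restrictRel {V : Type*} (A : V → V → Prop) (X : Set V) (u v : V) : Prop :=
  A u v ∧ u ∈ X ∧ v ∈ X

theorem restrictRel_mono {V : Type*} {A : V → V → Prop} {X Y : Set V} (h : X ⊆ Y) {u v : V}
    (huv : restrictRel A X u v) : restrictRel A Y u v :=
  ⟨huv.1, h huv.2.1, h huv.2.2⟩

theorem transGen_of_imp {V : Type*} {r s : V → V → Prop} (h : ∀ a b, r a b → s a b) {u v : V}
    (huv : TransGen r u v) : TransGen s u v := by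
  induction huv with
  | single h' => exact .single (h _ _ h')
  | tail _ h' ih => exact ih.tail (h _ _ h')

/-- `v` can be reached from `u` by a directed path on which the weight never drops below the
smaller of the weights of the two ends. -/
def HighPath {V : Type*} (A : V → V → Prop) (R : V → ℕ) (u v : V) : Prop :=
  TransGen (restrictRel A {w | min (R u) (R v) ≤ R w}) u v

theorem HighPath.transGen {V : Type*} {A : V → V → Prop} {R : V → ℕ} {u v : V}
    (h : HighPath A R u v) : TransGen A u v :=
  transGen_of_imp (fun _ _ hab => hab.1) h

theorem lt_of_transGen {V α : Type*} [Preorder α] {A : V → V → Prop} {g : V → α}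
    (hA : ∀ u v, A u v → g u < g v) {u v : V} (h : TransGen A u v) : g u < g v := by
  induction h with
  | single h => exact hA _ _ h
  | tail _ h ih => exact ih.trans (hA _ _ h)

/-! ### Realization by functions and by curves -/

/-- A tent of height one and width one centred at the origin. -/
noncomputable def tent (x : ℝ) : ℝ := max 0 (1 - 2 * |x|)

theorem tent_nonneg (x : ℝ) : 0 ≤ tent x := le_max_left _ _

theorem continuous_tent : Continuous tent := by
  unfold tent; fun_prop

theorem tent_zero : tent 0 = 1 := by simp [tent]

theorem tent_eq_zero {x : ℝ} (h : 1 / 2 ≤ |x|) : tent x = 0 :=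
  max_eq_left (by linarith)

/-- Functions on a half line that keep exactly the order relations forced by high paths: two
functions joined by a high path stay strictly ordered on their common domain, any other two
functions meet there. -/
theorem exists_oneSided {V : Type*} [Finite V] (A : V → V → Prop) (g : V → ℝ)
    (hA : ∀ u v, A u v → g u < g v) (R : V → ℕ) :
    ∃ (F : V → ℝ → ℝ) (r : V → ℝ), (∀ v, Continuous (F v)) ∧ (∀ v, 0 < r v) ∧
      (∀ v x, x ≤ 0 → F v x = 0) ∧
      (∀ u v, HighPath A R u v → ∀ x, x ≤ r u → x ≤ r v → g u + F u x < g v + F v x) ∧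
      (∀ u v, u ≠ v → g u ≤ g v → ¬ HighPath A R u v →
        ∃ x, 0 ≤ x ∧ x ≤ r u ∧ x ≤ r v ∧ g u + F u x = g v + F v x) := by
  classical
  have := Fintype.ofFinite V
  obtain ⟨M, ⟨e⟩⟩ := Finite.exists_equiv_fin (V × V)
  let lev : V × V → ℕ := fun p => min (R p.1) (R p.2)
  -- Level l owns the slots lM + 1, ..., lM + M, and each pair has its own slot. The first slot is
  -- at 1, so no tent reaches x ≤ 0.
  let pos : V × V → ℕ := fun p => lev p * M + e p + 1
  let up : V × V → V → Prop := fun p v =>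
    ReflTransGen (restrictRel A {w | lev p ≤ R w}) p.1 v
  -- At the slot of (u, v), the vertex u and all those above it by paths of weight at least the
  -- level rise by g v - g u. So u meets v unless v rises too.
  let F : V → ℝ → ℝ := fun v x =>
    ∑ p : V × V, (if up p v then max (g p.2 - g p.1) 0 else 0) * tent (x - pos p)
  -- Half a unit past the last slot of level `R v`: the tents centred in this range are those of
  -- level at most `R v`.
  let r : V → ℝ := fun v => (((R v + 1) * M : ℕ) : ℝ) + 1 / 2
  have hpos_inj : ∀ p q, pos p = pos q → p = q := by
    intro p q h
    have h' : lev p * M + (e p : ℕ) = lev q * M + e q := by simpa [pos] using h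
    have h2 := congrArg (· % M) h'
    simp only [Nat.mul_add_mod_self_right, Nat.mod_eq_of_lt (e p).2,
      Nat.mod_eq_of_lt (e q).2] at h2
    exact e.injective (Fin.ext h2)
  have hlev : ∀ p v (x : ℝ), x ≤ r v → tent (x - pos p) ≠ 0 → lev p ≤ R v := by
    intro p v x hx ht
    have h1 : |x - pos p| < 1 / 2 := by
      by_contra h
      exact ht (tent_eq_zero (not_lt.1 h))
    have h2 : (pos p : ℝ) < (((R v + 1) * M + 1 : ℕ) : ℝ) := by
      have := (abs_lt.1 h1).1
      push_cast
      simp only [r] at hx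
      push_cast at hx
      linarith
    have h3 : lev p * M + e p + 1 < (R v + 1) * M + 1 := by exact_mod_cast h2
    have h4 : lev p * M < (R v + 1) * M := by omega
    exact Nat.lt_succ_iff.1 (lt_of_mul_lt_mul_right h4 (Nat.zero_le M))
  have hposle : ∀ u v w, (w = u ∨ w = v) → (pos (u, v) : ℝ) ≤ r w := by
    intro u v w hw
    have h1 : lev (u, v) ≤ R w := by
      rcases hw with rfl | rfl
      · exact min_le_left _ _
      · exact min_le_right _ _
    have h2 : pos (u, v) ≤ (R w + 1) * M := by
      have := (e (u, v)).2
      have := Nat.mul_le_mul_right M h1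
      simp only [pos, Nat.add_mul, one_mul]
      omega
    have h3 : (pos (u, v) : ℝ) ≤ (((R w + 1) * M : ℕ) : ℝ) := by exact_mod_cast h2
    simp only [r]
    linarith
  refine ⟨F, r, ?_, ?_, ?_, ?_, ?_⟩
  · intro v
    have := continuous_tent
    simp only [F]
    fun_prop
  · intro v
    simp only [r]
    positivity
  · intro v x hx
    refine Finset.sum_eq_zero fun p _ => ?_
    have h1 : (1 : ℝ) ≤ pos p := by exact_mod_cast Nat.le_add_left 1 _
    rw [tent_eq_zero, mul_zero]
    rw [abs_of_nonpos (by linarith)]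
    linarith
  · intro u v huv x hxu hxv
    have hg : g u < g v := lt_of_transGen hA huv.transGen
    refine add_lt_add_of_lt_of_le hg (Finset.sum_le_sum fun p _ => ?_)
    by_cases ht : tent (x - pos p) = 0
    · simp [ht]
    refine mul_le_mul_of_nonneg_right ?_ (tent_nonneg _)
    have hu := hlev p u x hxu ht
    have hv := hlev p v x hxv ht
    by_cases hpu : up p u
    · have hpv : up p v := by
        refine ReflTransGen.trans hpu (TransGen.to_reflTransGen ?_)
        exact transGen_of_imp (fun _ _ hab => restrictRel_mono
          (fun w hw => (le_min hu hv).trans hw) hab) huv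
      rw [if_pos hpu, if_pos hpv]
    · rw [if_neg hpu]
      split_ifs
      · exact le_max_right _ _
      · exact le_rfl
  · intro u v hne hg huv
    have hF : ∀ w, F w (pos (u, v)) = if up (u, v) w then g v - g u else 0 := by
      intro w
      simp only [F]
      rw [Finset.sum_eq_single (u, v)]
      · rw [sub_self, tent_zero, mul_one, max_eq_left (sub_nonneg.2 hg)]
      · intro p _ hp
        rw [tent_eq_zero, mul_zero]
        have h1 : (pos (u, v) : ℤ) - pos p ≠ 0 := by
          intro h
          exact hp (hpos_inj _ _ (by omega))
        have h2 : (1 : ℝ) ≤ |(pos (u, v) : ℝ) - pos p| := by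
          exact_mod_cast Int.one_le_abs h1
        linarith
      · simp
    refine ⟨pos (u, v), Nat.cast_nonneg _, hposle u v u (.inl rfl), hposle u v v (.inr rfl), ?_⟩
    have hu : up (u, v) u := ReflTransGen.refl
    have hv : ¬ up (u, v) v := by
      intro h
      rcases reflTransGen_iff_eq_or_transGen.1 h with h | h
      · exact hne h.symm
      · exact huv h
    rw [hF, hF, if_pos hu, if_neg hv]
    ring

theorem isCurve_graphOn_Icc {a b : ℝ} (h : a < b) {f : ℝ → ℝ} (hf : Continuous f) :
    IsCurve ((fun x => (x, f x)) '' Set.Icc a b) := by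
  refine ⟨fun t => ((iccHomeoI a b h).symm t, f ((iccHomeoI a b h).symm t)), by fun_prop, ?_⟩
  ext p
  constructor
  · rintro ⟨t, rfl⟩
    exact ⟨_, ((iccHomeoI a b h).symm t).2, rfl⟩
  · rintro ⟨x, hx, rfl⟩
    exact ⟨iccHomeoI a b h ⟨x, hx⟩, by simp⟩

theorem isXMonotone_graph (s : Set ℝ) (f : ℝ → ℝ) : IsXMonotone ((fun x => (x, f x)) '' s) := by
  rintro a _ ⟨⟨x, _, rfl⟩, hx⟩ _ ⟨⟨y, _, rfl⟩, hy⟩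
  have hx' : x = a := hx
  have hy' : y = a := hy
  rw [hx', hy']

/-- An acyclic relation with two weights is realized by x-monotone curves through the `y`-axis:
disjointness means being joined, in the same direction, by high paths for both weights. -/
theorem exists_curves {V : Type*} [Finite V] (A : V → V → Prop) (g : V → ℝ)
    (hg : Function.Injective g) (hA : ∀ u v, A u v → g u < g v) (L R : V → ℕ) :
    ∃ C : V → Set (ℝ × ℝ), Function.Injective C ∧ (∀ v, IsCurve (C v) ∧ IsXMonotone (C v)) ∧
      (∀ v, (C v ∩ verticalLine 0).Nonempty) ∧
      ∀ u v, u ≠ v → (Disjoint (C u) (C v) ↔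
        (HighPath A L u v ∧ HighPath A R u v) ∨ (HighPath A L v u ∧ HighPath A R v u)) := by
  obtain ⟨F, r, hFc, hr, hF0, hFlt, hFeq⟩ := exists_oneSided A g hA R
  obtain ⟨G, l, hGc, hl, hG0, hGlt, hGeq⟩ := exists_oneSided A g hA L
  -- Each of the two perturbations vanishes on the other half line, so the sides are independent.
  let f : V → ℝ → ℝ := fun v x => g v + F v x + G v (-x)
  let C : V → Set (ℝ × ℝ) := fun v => (fun x => (x, f v x)) '' Set.Icc (-l v) (r v)
  have hf0 : ∀ v, f v 0 = g v := fun v => by simp [f, hF0 v 0 le_rfl, hG0 v 0 le_rfl]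
  have hmem : ∀ v x y, (x, y) ∈ C v ↔ (-l v ≤ x ∧ x ≤ r v) ∧ f v x = y := by
    intro v x y
    simp [C]
  have hmem0 : ∀ v, ((0 : ℝ), g v) ∈ C v := fun v =>
    (hmem v 0 _).2 ⟨⟨by linarith [hl v], (hr v).le⟩, hf0 v⟩
  have hdisj : ∀ u v, HighPath A L u v → HighPath A R u v → Disjoint (C u) (C v) := by
    intro u v hL hR
    rw [Set.disjoint_left]
    rintro ⟨x, y⟩ hu hv
    obtain ⟨⟨hu1, hu2⟩, hu3⟩ := (hmem u x y).1 hu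
    obtain ⟨⟨hv1, hv2⟩, hv3⟩ := (hmem v x y).1 hv
    simp only [f] at hu3 hv3
    rcases le_total 0 x with hx | hx
    · have := hFlt u v hR x hu2 hv2
      have h1 := hG0 u (-x) (by linarith)
      have h2 := hG0 v (-x) (by linarith)
      linarith
    · have := hGlt u v hL (-x) (by linarith) (by linarith)
      have h1 := hF0 u x hx
      have h2 := hF0 v x hx
      linarith
  have hmeet : ∀ u v, u ≠ v → g u ≤ g v → Disjoint (C u) (C v) →
      HighPath A L u v ∧ HighPath A R u v := by
    intro u v hne hguv hd
    rw [Set.disjoint_left] at hd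
    constructor
    · by_contra h
      obtain ⟨x, hx0, hxu, hxv, hx⟩ := hGeq u v hne hguv h
      refine hd ((hmem u (-x) _).2 ⟨⟨by linarith, by linarith [hr u]⟩, rfl⟩)
        ((hmem v (-x) _).2 ⟨⟨by linarith, by linarith [hr v]⟩, ?_⟩)
      simp only [f, neg_neg, hF0 _ (-x) (by linarith : -x ≤ 0)]
      linarith
    · by_contra h
      obtain ⟨x, hx0, hxu, hxv, hx⟩ := hFeq u v hne hguv h
      refine hd ((hmem u x _).2 ⟨⟨by linarith [hl u], by linarith⟩, rfl⟩)
        ((hmem v x _).2 ⟨⟨by linarith [hl v], by linarith⟩, ?_⟩)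
      simp only [f, hG0 _ (-x) (by linarith : -x ≤ 0)]
      linarith
  refine ⟨C, ?_, ?_, fun v => ⟨_, hmem0 v, rfl⟩, ?_⟩
  · intro u v huv
    have h := hmem0 u
    rw [huv] at h
    have := ((hmem v 0 _).1 h).2
    rw [hf0] at this
    exact hg this.symm
  · intro v
    have hfc : Continuous (f v) := by
      have := hFc v
      have := hGc v
      simp only [f]
      fun_prop
    exact ⟨isCurve_graphOn_Icc (by linarith [hl v, hr v]) hfc, isXMonotone_graph _ _⟩
  · intro u v hne
    constructor
    · intro hd
      rcases le_total (g u) (g v) with h | h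
      · exact .inl (hmeet u v hne h hd)
      · exact .inr (hmeet v u hne.symm h hd.symm)
    · rintro (⟨h1, h2⟩ | ⟨h1, h2⟩)
      · exact hdisj u v h1 h2
      · exact (hdisj v u h1 h2).symm

/-! ### The Zykov-type digraph -/

/-- The arcs of the Zykov-type digraph built from `n` copies of a digraph and one new sink for each
choice of a vertex from every copy. -/
inductive ZykovArc {V : Type} (A : V → V → Prop) (n : ℕ) :
    (Fin n × V) ⊕ (Fin n → V) → (Fin n × V) ⊕ (Fin n → V) → Prop
  | copy (i : Fin n) (u v : V) (h : A u v) : ZykovArc A n (.inl (i, u)) (.inl (i, v))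
  | sink (i : Fin n) (f : Fin n → V) : ZykovArc A n (.inl (i, f i)) (.inr f)

/-- No arc leaves a sink, so a walk stays in one copy except perhaps for its final arc, and that arc
can reach the sink f only from `f i`. -/
theorem transGen_zykovArc_inl {V : Type} {A : V → V → Prop} {n : ℕ}
    {X : Set ((Fin n × V) ⊕ (Fin n → V))} {s x : (Fin n × V) ⊕ (Fin n → V)}
    (h : TransGen (restrictRel (ZykovArc A n) X) s x) :
    ∃ i u, s = .inl (i, u) ∧
      ((∃ v, x = .inl (i, v) ∧ TransGen (restrictRel A {w | .inl (i, w) ∈ X}) u v) ∨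
        ∃ f, x = .inr f ∧ .inl (i, f i) ∈ X ∧
          ReflTransGen (restrictRel A {w | .inl (i, w) ∈ X}) u (f i)) := by
  induction h with
  | single h =>
    obtain ⟨h, hs, hx⟩ := h
    cases h with
    | copy i u v h => exact ⟨i, u, rfl, .inl ⟨v, rfl, .single ⟨h, hs, hx⟩⟩⟩
    | sink i f => exact ⟨i, _, rfl, .inr ⟨f, rfl, hs, .refl⟩⟩
  | tail _ h ih =>
    obtain ⟨h, hs, hx⟩ := h
    obtain ⟨i, u, rfl, ⟨v, rfl, hv⟩ | ⟨f, rfl, -⟩⟩ := ih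
    · cases h with
      | copy _ _ v' h => exact ⟨i, u, rfl, .inl ⟨v', rfl, hv.tail ⟨h, hs, hx⟩⟩⟩
      | sink _ f => exact ⟨i, u, rfl, .inr ⟨f, rfl, hs, hv.to_reflTransGen⟩⟩
    · cases h

theorem transGen_zykovArc_copy {V : Type} {A : V → V → Prop} {n : ℕ} (i : Fin n)
    {Y : Set V} {X : Set ((Fin n × V) ⊕ (Fin n → V))} (h : ∀ w ∈ Y, .inl (i, w) ∈ X) {u v : V}
    (huv : TransGen (restrictRel A Y) u v) :
    TransGen (restrictRel (ZykovArc A n) X) (.inl (i, u)) (.inl (i, v)) := by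
  have step : ∀ a b, restrictRel A Y a b →
      restrictRel (ZykovArc A n) X (.inl (i, a)) (.inl (i, b)) := fun a b hab =>
    ⟨.copy i a b hab.1, h a hab.2.1, h b hab.2.2⟩
  induction huv with
  | single h' => exact .single (step _ _ h')
  | tail _ h' ih => exact ih.tail (step _ _ h')

/-- For every `n` there is a finite digraph whose vertices have `n` colours that increase along
the arcs, in which every vertex lying on some walk from `s` to `u` lies on all of them, which has no
proper colouring with fewer than `n` colours, and which has directed paths through all sets of
colours. -/
theorem exists_zykov (n : ℕ) :
    ∃ (V : Type) (_ : Finite V) (A : V → V → Prop) (col : V → ℕ),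
      (∀ v, col v < n) ∧ (∀ u v, A u v → col u < col v) ∧
      (∀ (X : Set V) (s t u : V), TransGen A s t → TransGen A t u →
        TransGen (restrictRel A X) s u → t ∈ X) ∧
      (∀ c : V → ℕ, (∀ u v, A u v → c u ≠ c v) → n ≤ (Set.range c).ncard) ∧
      (∀ S : Finset ℕ, S.Nonempty → (∀ i ∈ S, i < n) → ∃ p : ℕ → V, (∀ i ∈ S, col (p i) = i) ∧
        ∀ i ∈ S, ∀ j ∈ S, i < j → TransGen (restrictRel A {w | col w ∈ S}) (p i) (p j)) := by
  classical
  induction n with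
  | zero =>
    refine ⟨Empty, inferInstance, fun _ _ => False, fun _ => 0, ?_⟩
    refine ⟨nofun, nofun, nofun, fun _ _ => Nat.zero_le _, ?_⟩
    rintro S ⟨i, hi⟩ hS
    exact absurd (hS i hi) (Nat.not_lt_zero i)
  | succ n ih =>
    obtain ⟨V, hV, A, col, hcol, hA, hU, hχ, hp⟩ := ih
    have hmono : ∀ {X : Set V} {u v : V}, TransGen (restrictRel A X) u v → TransGen A u v :=
      fun h => transGen_of_imp (fun _ _ hab => hab.1) h
    have hrestr : ∀ {s t}, TransGen (ZykovArc A n) s t →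
        TransGen (restrictRel (ZykovArc A n) Set.univ) s t :=
      fun h => transGen_of_imp (fun _ _ hab => ⟨hab, trivial, trivial⟩) h
    refine ⟨(Fin n × V) ⊕ (Fin n → V), inferInstance, ZykovArc A n,
      Sum.elim (fun x => col x.2) (fun _ => n), ?_, ?_, ?_, ?_, ?_⟩
    · rintro (x | f)
      · exact (hcol _).trans (Nat.lt_succ_self n)
      · exact Nat.lt_succ_self n
    · rintro _ _ (⟨i, u, v, h⟩ | ⟨i, f⟩)
      · exact hA _ _ h
      · exact hcol _
    · intro X s t u hst htu hsu
      obtain ⟨i, t', rfl, ht⟩ := transGen_zykovArc_inl (hrestr htu)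
      obtain ⟨j, s', rfl, hs⟩ := transGen_zykovArc_inl (hrestr hst)
      obtain ⟨t'', h, hst'⟩ | ⟨f, h, -⟩ := hs
      swap
      · cases h
      cases h
      have hst'' := hmono hst'
      obtain ⟨j', s'', h, hs⟩ := transGen_zykovArc_inl hsu
      cases h
      obtain ⟨u', rfl, hsu'⟩ | ⟨f, rfl, hfX, hsu'⟩ := hs
      · obtain ⟨_, h, htu'⟩ | ⟨f, h, -⟩ := ht
        · cases h
          exact hU _ _ _ _ hst'' (hmono htu') hsu'
        · cases h
      · obtain ⟨_, h, -⟩ | ⟨f', h, -, htf⟩ := ht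
        · cases h
        cases h
        rcases reflTransGen_iff_eq_or_transGen.1 htf with h | h
        · rwa [h] at hfX
        · rcases reflTransGen_iff_eq_or_transGen.1 hsu' with h' | h'
          -- Here s is `f i`, so t would lie on a closed walk, against the increase of colours.
          · have h1 := lt_of_transGen hA hst''
            have h2 := lt_of_transGen hA (hmono h)
            rw [h'] at h2
            exact absurd (h1.trans h2) (lt_irrefl _)
          · exact hU _ _ _ _ hst'' (hmono h) h'
    · intro c hc
      have hfin : (Set.range c).Finite := Set.finite_range c
      let T : Fin n → Finset ℕ := fun i => (Set.finite_range fun v => c (.inl (i, v))).toFinset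
      have hT : ∀ i, n ≤ (T i).card := fun i => by
        rw [← Set.ncard_eq_toFinset_card _ (Set.finite_range _)]
        exact hχ _ fun u v h => hc _ _ (.copy i u v h)
      -- Hall's theorem: every copy shows at least n colours, so distinct ones can be picked; the
      -- sink over them needs yet another.
      obtain ⟨f, hf, hfT⟩ := (Finset.all_card_le_biUnion_card_iff_exists_injective T).1 (by
        intro s
        rcases s.eq_empty_or_nonempty with rfl | ⟨i, hi⟩
        · simp
        · calc s.card ≤ n := by simpa using s.card_le_univ
            _ ≤ (T i).card := hT i
            _ ≤ _ := Finset.card_le_card (Finset.subset_biUnion_of_mem T hi))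
      have hw : ∀ i, ∃ v, c (.inl (i, v)) = f i := fun i => by simpa [T] using hfT i
      choose w hw using hw
      have h1 : c (.inr w) ∉ Set.range f := by
        rintro ⟨i, hi⟩
        exact hc _ _ (.sink i w) ((hw i).trans hi)
      have h2 : insert (c (.inr w)) (Set.range f) ⊆ Set.range c := by
        rintro _ (rfl | ⟨i, rfl⟩)
        · exact ⟨_, rfl⟩
        · exact ⟨_, hw i⟩
      calc n + 1 = (insert (c (.inr w)) (Set.range f)).ncard := by
            rw [Set.ncard_insert_of_notMem h1 (Set.finite_range f),
              Set.ncard_range_of_injective hf]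
            simp
        _ ≤ _ := Set.ncard_le_ncard h2 hfin
    · intro S hSne hS
      have hlt : ∀ i ∈ S, i ≠ n → i < n := fun i hi hne =>
        lt_of_le_of_ne (Nat.lt_succ_iff.1 (hS i hi)) hne
      rcases (S.erase n).eq_empty_or_nonempty with hE | hE
      · have hSn : ∀ i ∈ S, i = n := fun i hi => by
          by_contra h
          simpa [hE] using Finset.mem_erase.2 ⟨h, hi⟩
        have hf : Nonempty (Fin n → V) := by
          rcases n.eq_zero_or_pos with rfl | h0
          · exact ⟨Fin.elim0⟩
          · obtain ⟨p, -⟩ := hp {0} (Finset.singleton_nonempty 0) (by simpa using h0)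
            exact ⟨fun _ => p 0⟩
        obtain ⟨f⟩ := hf
        refine ⟨fun _ => .inr f, fun i hi => (hSn i hi).symm, fun i hi j hj hij => ?_⟩
        rw [hSn i hi, hSn j hj] at hij
        exact absurd hij (lt_irrefl _)
      · obtain ⟨p, hpc, hpt⟩ := hp (S.erase n) hE
          fun i hi => hlt i (Finset.mem_of_mem_erase hi) (Finset.ne_of_mem_erase hi)
        let m := (S.erase n).max' hE
        have hm : m ∈ S.erase n := Finset.max'_mem _ _
        have hm' := Finset.mem_of_mem_erase hm
        let i₀ : Fin n :=
          ⟨0, (Nat.zero_le m).trans_lt (hlt m hm' (Finset.ne_of_mem_erase hm))⟩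
        -- Only the copy `i₀` matters: this sink prolongs the path there beyond its last vertex.
        let f : Fin n → V := fun _ => p m
        have hcopy : ∀ i ∈ S.erase n, ∀ j ∈ S.erase n, i < j →
            TransGen (restrictRel (ZykovArc A n)
              {w | Sum.elim (fun x => col x.2) (fun _ => n) w ∈ S})
              (.inl (i₀, p i)) (.inl (i₀, p j)) := fun i hi j hj hij =>
          transGen_zykovArc_copy (Y := {w | col w ∈ S.erase n}) i₀
            (fun w (hw : col w ∈ S.erase n) => (Finset.mem_of_mem_erase hw : col w ∈ S)) (hpt i hi j hj hij)
        refine ⟨fun i => if i = n then .inr f else .inl (i₀, p i), fun i hi => ?_,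
          fun i hi j hj hij => ?_⟩
        · by_cases h : i = n
          · simp [h]
          · simpa [h] using hpc i (Finset.mem_erase.2 ⟨h, hi⟩)
        · have hin : i ≠ n := fun h => by
            have := hS j hj
            omega
          have hiE := Finset.mem_erase.2 ⟨hin, hi⟩
          beta_reduce
          rw [if_neg hin]
          by_cases hjn : j = n
          · rw [if_pos hjn]
            have hlast : restrictRel (ZykovArc A n)
                {w | Sum.elim (fun x => col x.2) (fun _ => n) w ∈ S}
                (.inl (i₀, p m)) (.inr f) :=
              ⟨.sink i₀ f, by simpa [hpc m hm] using hm', by simpa [hjn] using hj⟩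
            rcases (Finset.le_max' _ _ hiE).eq_or_lt with h | h
            · rw [h]
              exact .single hlast
            · exact (hcopy i hiE m hm h).tail hlast
          · rw [if_neg hjn]
            exact hcopy i hiE j (Finset.mem_erase.2 ⟨hjn, hj⟩) hij

/-! ### Colours as quadruples, and their two weights -/

theorem mul_add_lt_mul_add {B x y r s : ℕ} (h : x < y) (hr : r < B) :
    x * B + r < y * B + s := by
  have := Nat.mul_le_mul_right B (Nat.succ_le_of_lt h)
  rw [Nat.succ_mul] at this
  omega

theorem six_mul_sum_sq (n : ℕ) :
    6 * ∑ d ∈ Finset.range n, (n - d) ^ 2 = n * (n + 1) * (2 * n + 1) := by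
  induction n with
  | zero => simp
  | succ n ih =>
    rw [Finset.sum_range_succ', mul_add]
    simp only [Nat.add_sub_add_right, Nat.sub_zero]
    rw [ih]
    ring

theorem twelve_mul_sum_sq (k : ℕ) :
    12 * ∑ a ∈ Finset.range k, ∑ d ∈ Finset.range (k - a), (k - a - d) ^ 2 =
      k * (k + 1) ^ 2 * (k + 2) := by
  induction k with
  | zero => simp
  | succ k ih =>
    rw [Finset.sum_range_succ', mul_add]
    simp only [Nat.add_sub_add_right, Nat.sub_zero]
    rw [ih]
    have := six_mul_sum_sq (k + 1)
    linarith

/-- How two quadruples of coordinates compare, and how the two weights compare accordingly. -/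
def StepType (a d b c L R : ℕ → ℕ) (i j : ℕ) : Prop :=
  (a i < a j ∧ L i < L j ∧ R i < R j) ∨
  (a i = a j ∧ d j < d i ∧ L j < L i ∧ R j < R i) ∨
  (a i = a j ∧ d i = d j ∧ b i < b j ∧ L i < L j ∧ R j < R i) ∨
  (a i = a j ∧ d i = d j ∧ b i = b j ∧ c i < c j ∧ L j < L i ∧ R i < R j)

/-- The quadruples `(a, d, b, c)` with `b, c < k - a - d`, listed in lexicographic order with
the order of `d` reversed, and two weights on them. -/
theorem exists_blocks (k : ℕ) :
    ∃ (N : ℕ) (a d b c L R : ℕ → ℕ), 12 * N = k * (k + 1) ^ 2 * (k + 2) ∧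
      (∀ i < N, b i < k - a i - d i ∧ c i < k - a i - d i) ∧
      (∀ i j, i < j → j < N → StepType a d b c L R i j) ∧
      (∀ t < k, ∃ i < N, a i = t ∧ d i = 0 ∧ b i = 0 ∧ c i = 0) := by
  classical
  let T : Finset (Σ _ : (Σ _ : ℕ, ℕ), ℕ × ℕ) :=
    ((Finset.range k).sigma fun a => Finset.range (k - a)).sigma fun x =>
      Finset.range (k - x.1 - x.2) ×ˢ Finset.range (k - x.1 - x.2)
  have hT : 12 * T.card = k * (k + 1) ^ 2 * (k + 2) := by
    rw [← twelve_mul_sum_sq]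
    simp only [T, Finset.card_sigma, Finset.card_product, Finset.card_range, Finset.sum_sigma,
      sq]
  have hmem : ∀ x, x ∈ T ↔ (x.1.1 < k ∧ x.1.2 < k - x.1.1) ∧
      x.2.1 < k - x.1.1 - x.1.2 ∧ x.2.2 < k - x.1.1 - x.1.2 := by
    intro x
    simp [T]
  let B := k + 1
  -- Numbers in base k + 1 with digits at most k; a digit k - x reverses the order of that
  -- coordinate. The code and both weights are decided by the first differing coordinate.
  let code : (Σ _ : (Σ _ : ℕ, ℕ), ℕ × ℕ) → ℕ := fun x =>
    ((x.1.1 * B + (k - x.1.2)) * B + x.2.1) * B + x.2.2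
  let wL : (Σ _ : (Σ _ : ℕ, ℕ), ℕ × ℕ) → ℕ := fun x =>
    ((x.1.1 * B + x.1.2) * B + x.2.1) * B + (k - x.2.2)
  let wR : (Σ _ : (Σ _ : ℕ, ℕ), ℕ × ℕ) → ℕ := fun x =>
    ((x.1.1 * B + x.1.2) * B + (k - x.2.1)) * B + x.2.2
  have hstep : ∀ x ∈ T, ∀ y ∈ T, code x < code y →
      (x.1.1 < y.1.1 ∧ wL x < wL y ∧ wR x < wR y) ∨
      (x.1.1 = y.1.1 ∧ y.1.2 < x.1.2 ∧ wL y < wL x ∧ wR y < wR x) ∨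
      (x.1.1 = y.1.1 ∧ x.1.2 = y.1.2 ∧ x.2.1 < y.2.1 ∧ wL x < wL y ∧ wR y < wR x) ∨
      (x.1.1 = y.1.1 ∧ x.1.2 = y.1.2 ∧ x.2.1 = y.2.1 ∧ x.2.2 < y.2.2 ∧ wL y < wL x ∧
        wR x < wR y) := by
    rintro ⟨⟨a, d⟩, b, c⟩ hx ⟨⟨a', d'⟩, b', c'⟩ hy
    obtain ⟨⟨h1, h2⟩, h3, h4⟩ := (hmem _).1 hx
    obtain ⟨⟨h1', h2'⟩, h3', h4'⟩ := (hmem _).1 hy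
    simp only [code, wL, wR, B]
    simp only at h1 h2 h3 h4 h1' h2' h3' h4'
    have key : ∀ {x y r s : ℕ}, x < y → r ≤ k → x * (k + 1) + r < y * (k + 1) + s :=
      fun h hr => mul_add_lt_mul_add h (Nat.lt_succ_of_le hr)
    intro h
    rcases lt_trichotomy a a' with ha | rfl | ha
    · exact .inl ⟨ha, key (key (key ha (by omega)) (by omega)) (by omega),
        key (key (key ha (by omega)) (by omega)) (by omega)⟩
    · rcases lt_trichotomy d' d with hd | rfl | hd
      · have hd' : a * (k + 1) + d' < a * (k + 1) + d := by omega
        exact .inr (.inl ⟨rfl, hd, key (key hd' (by omega)) (by omega),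
          key (key hd' (by omega)) (by omega)⟩)
      · rcases lt_trichotomy b b' with hb | rfl | hb
        · exact .inr (.inr (.inl ⟨rfl, rfl, hb, key (by omega) (by omega),
            key (by omega) (by omega)⟩))
        · exact .inr (.inr (.inr ⟨rfl, rfl, rfl, by omega, by omega, by omega⟩))
        · exact absurd (h.trans (key (by omega) (by omega))) (lt_irrefl _)
      · exact absurd (h.trans (key (key (by omega) (by omega)) (by omega))) (lt_irrefl _)
    · exact absurd (h.trans (key (key (key ha (by omega)) (by omega)) (by omega)))
        (lt_irrefl _)
  have hinj : Set.InjOn code T := by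
    rintro ⟨⟨a, d⟩, b, c⟩ hx ⟨⟨a', d'⟩, b', c'⟩ hy h
    obtain ⟨⟨h1, h2⟩, h3, h4⟩ := (hmem _).1 hx
    obtain ⟨⟨h1', h2'⟩, h3', h4'⟩ := (hmem _).1 hy
    simp only [code, B] at h
    simp only at h1 h2 h3 h4 h1' h2' h3' h4'
    have key : ∀ {x y r s : ℕ}, x * (k + 1) + r = y * (k + 1) + s → r ≤ k → s ≤ k →
        x = y ∧ r = s := by
      intro x y r s h hr hs
      rcases lt_trichotomy x y with hxy | rfl | hxy
      · exact absurd h (mul_add_lt_mul_add hxy (Nat.lt_succ_of_le hr)).ne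
      · exact ⟨rfl, by omega⟩
      · exact absurd h (mul_add_lt_mul_add hxy (Nat.lt_succ_of_le hs)).ne'
    obtain ⟨e₁, e₂⟩ := key h (by omega) (by omega)
    obtain ⟨e₃, e₄⟩ := key e₁ (by omega) (by omega)
    obtain ⟨e₅, e₆⟩ := key e₃ (by omega) (by omega)
    have e₇ : d = d' := by omega
    rw [e₂, e₄, e₅, e₇]
  have hcard : (T.image code).card = T.card := Finset.card_image_of_injOn hinj
  let o := (T.image code).orderEmbOfFin hcard
  have ho : ∀ i : Fin T.card, ∃ x ∈ T, code x = o i := fun i =>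
    Finset.mem_image.1 (Finset.orderEmbOfFin_mem _ hcard i)
  choose q hqT hq using ho
  let q' : ℕ → (Σ _ : (Σ _ : ℕ, ℕ), ℕ × ℕ) := fun i =>
    if h : i < T.card then q ⟨i, h⟩ else ⟨⟨0, 0⟩, 0, 0⟩
  have hq' : ∀ i (h : i < T.card), q' i = q ⟨i, h⟩ := fun i h => dif_pos h
  refine ⟨T.card, fun i => (q' i).1.1, fun i => (q' i).1.2, fun i => (q' i).2.1,
    fun i => (q' i).2.2, fun i => wL (q' i), fun i => wR (q' i), hT, ?_, ?_, ?_⟩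
  · intro i hi
    have := ((hmem _).1 (hqT ⟨i, hi⟩)).2
    rwa [← hq'] at this
  · intro i j hij hj
    have hi := hij.trans hj
    have := hstep _ (hqT ⟨i, hi⟩) _ (hqT ⟨j, hj⟩) (by
      rw [hq, hq]
      exact o.strictMono hij)
    rwa [← hq', ← hq'] at this
  · intro t ht
    have hx : (⟨⟨t, 0⟩, 0, 0⟩ : Σ _ : (Σ _ : ℕ, ℕ), ℕ × ℕ) ∈ T := by
      rw [hmem]
      simp only
      omega
    have h1 : code ⟨⟨t, 0⟩, 0, 0⟩ ∈ Set.range o := by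
      rw [Finset.range_orderEmbOfFin]
      exact Finset.mem_coe.2 (Finset.mem_image_of_mem _ hx)
    obtain ⟨i, hi⟩ := h1
    refine ⟨i, i.2, ?_⟩
    have h2 : q' i = ⟨⟨t, 0⟩, 0, 0⟩ := by
      rw [hq' i i.2]
      exact hinj (hqT _) hx ((hq _).trans hi)
    simp [h2]

/-! ### The bound for valley-free sets -/

/-- A set of indices on which neither weight has a strict local minimum has at most `k`
elements. -/
theorem card_le_of_valleyFree {k N : ℕ} {a d b c L R : ℕ → ℕ}
    (hbd : ∀ i < N, b i < k - a i - d i ∧ c i < k - a i - d i)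
    (hst : ∀ i j, i < j → j < N → StepType a d b c L R i j)
    (S : Finset ℕ) (hS : ∀ i ∈ S, i < N)
    (hL : ∀ i ∈ S, ∀ j ∈ S, ∀ l ∈ S, i < j → j < l → ¬ (L j < L i ∧ L j < L l))
    (hR : ∀ i ∈ S, ∀ j ∈ S, ∀ l ∈ S, i < j → j < l → ¬ (R j < R i ∧ R j < R l)) :
    S.card ≤ k := by
  classical
  rcases S.eq_empty_or_nonempty with rfl | hne
  · simp
  have hst' : ∀ i ∈ S, ∀ j ∈ S, i < j → StepType a d b c L R i j := fun i _ j hj hij =>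
    hst i j hij (hS j hj)
  have hinj : ∀ (U : Finset ℕ) (f : ℕ → ℕ), U ⊆ S →
      (∀ i ∈ U, ∀ j ∈ U, i < j → f i ≠ f j) → Set.InjOn f U := by
    intro U f _ hf i hi j hj hij
    rcases lt_trichotomy i j with h | h | h
    · exact absurd hij (hf i hi j hj h)
    · exact h
    · exact absurd hij.symm (hf j hj i hi h)
  obtain ⟨z, hz, hzmax⟩ : ∃ z ∈ S, ∀ i ∈ S, i ≤ z :=
    ⟨S.max' hne, S.max'_mem hne, fun i hi => S.le_max' i hi⟩
  have haz : ∀ i ∈ S, a i ≤ a z := by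
    intro i hi
    rcases (hzmax i hi).eq_or_lt with rfl | h
    · exact le_rfl
    · rcases hst' i hi z hz h with h | h | h | h <;> omega
  let S₁ := S.filter fun i => a i < a z
  let S₂ := S.filter fun i => ¬ a i < a z
  have hS₂ : ∀ i ∈ S₂, i ∈ S ∧ a i = a z := fun i hi => by
    have h := Finset.mem_filter.1 hi
    exact ⟨h.1, le_antisymm (haz i h.1) (not_lt.1 h.2)⟩
  have hne₂ : S₂.Nonempty := ⟨z, Finset.mem_filter.2 ⟨hz, lt_irrefl _⟩⟩
  obtain ⟨f, hf, hfmin⟩ : ∃ f ∈ S₂, ∀ i ∈ S₂, f ≤ i :=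
    ⟨S₂.min' hne₂, S₂.min'_mem hne₂, fun i hi => S₂.min'_le i hi⟩
  obtain ⟨hfS, hfa⟩ := hS₂ f hf
  have hdf : ∀ i ∈ S₂, d i ≤ d f := by
    intro i hi
    obtain ⟨hiS, hia⟩ := hS₂ i hi
    rcases (hfmin i hi).eq_or_lt with rfl | h
    · exact le_rfl
    · rcases hst' f hfS i hiS h with h | h | h | h <;> omega
  let S₃ := S₂.filter fun i => d i < d f
  let S₄ := S₂.filter fun i => ¬ d i < d f
  have hS₄ : ∀ i ∈ S₄, i ∈ S ∧ a i = a z ∧ d i = d f := fun i hi => by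
    have h := Finset.mem_filter.1 hi
    exact ⟨(hS₂ i h.1).1, (hS₂ i h.1).2, le_antisymm (hdf i h.1) (not_lt.1 h.2)⟩
  -- Between two members with the same a some weight falls, and the passage to z raises both: a
  -- valley.
  have hc₁ : S₁.card ≤ a z := by
    rw [← Finset.card_range (a z)]
    refine Finset.card_le_card_of_injOn a (fun i hi => ?_) (hinj S₁ a (Finset.filter_subset _ _) ?_)
    · exact Finset.mem_coe.2 (Finset.mem_range.2 (Finset.mem_filter.1 hi).2)
    · intro i hi j hj hij he
      obtain ⟨hiS, hia⟩ := Finset.mem_filter.1 hi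
      obtain ⟨hjS, hja⟩ := Finset.mem_filter.1 hj
      have hjz : j < z := lt_of_le_of_ne (hzmax j hjS) (by rintro rfl; omega)
      have := hL i hiS j hjS z hz hij hjz
      have := hR i hiS j hjS z hz hij hjz
      have h1 := hst' i hiS j hjS hij
      have h2 := hst' j hjS z hz hjz
      simp only [StepType] at h1 h2
      omega
  -- From f onwards to a smaller d both weights fall, and between two members with the same d one
  -- rises: a valley.
  have hc₃ : S₃.card ≤ d f := by
    rw [← Finset.card_range (d f)]
    refine Finset.card_le_card_of_injOn d (fun i hi => ?_)
      (hinj S₃ d ((Finset.filter_subset _ _).trans (Finset.filter_subset _ _)) ?_)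
    · exact Finset.mem_coe.2 (Finset.mem_range.2 (Finset.mem_filter.1 hi).2)
    · intro i hi j hj hij he
      obtain ⟨hi₂, hid⟩ := Finset.mem_filter.1 hi
      obtain ⟨hj₂, hjd⟩ := Finset.mem_filter.1 hj
      obtain ⟨hiS, hia⟩ := hS₂ i hi₂
      obtain ⟨hjS, hja⟩ := hS₂ j hj₂
      have hfi : f < i := lt_of_le_of_ne (hfmin i hi₂) (by rintro rfl; omega)
      have := hL f hfS i hiS j hjS hfi hij
      have := hR f hfS i hiS j hjS hfi hij
      have h1 := hst' f hfS i hiS hfi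
      have h2 := hst' i hiS j hjS hij
      simp only [StepType] at h1 h2
      omega
  have hc₄ : S₄.card ≤ k - a z - d f := by
    rw [← Finset.card_range (k - a z - d f)]
    have hsub : S₄ ⊆ S := (Finset.filter_subset _ _).trans (Finset.filter_subset _ _)
    by_cases hb : ∀ i ∈ S₄, ∀ j ∈ S₄, i < j → b i ≠ b j
    · refine Finset.card_le_card_of_injOn b (fun i hi => ?_) (hinj S₄ b hsub hb)
      obtain ⟨hiS, hia, hid⟩ := hS₄ i hi
      have := (hbd i (hS i hiS)).1
      rw [hia, hid] at this
      exact Finset.mem_coe.2 (Finset.mem_range.2 this)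
    · push Not at hb
      obtain ⟨u, hu, v, hv, huv, hbuv⟩ := hb
      obtain ⟨huS, hua, hud⟩ := hS₄ u hu
      obtain ⟨hvS, hva, hvd⟩ := hS₄ v hv
      have huvs := hst' u huS v hvS huv
      -- From u to v, L falls and R rises. An earlier member with another b creates a valley of R at
      -- u, a later one a valley of L at v; a member in between is squeezed to the same b.
      have hall : ∀ i ∈ S₄, b i = b u := by
        intro i hi
        obtain ⟨hiS, hia, hid⟩ := hS₄ i hi
        by_contra hne
        rcases lt_or_ge i u with h | h
        · have := hR i hiS u huS v hvS h huv
          have h1 := hst' i hiS u huS h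
          simp only [StepType] at h1 huvs
          omega
        · have hui : u < i := lt_of_le_of_ne h (by rintro rfl; exact hne rfl)
          have h1 := hst' u huS i hiS hui
          have hvi : v < i := by
            rcases lt_trichotomy i v with h | rfl | h
            · have h2 := hst' i hiS v hvS h
              simp only [StepType] at h1 h2
              omega
            · exact absurd hbuv.symm hne
            · exact h
          have := hL u huS v hvS i hiS huv hvi
          have h2 := hst' v hvS i hiS hvi
          simp only [StepType] at h1 h2 huvs
          omega
      refine Finset.card_le_card_of_injOn c (fun i hi => ?_) (hinj S₄ c hsub ?_)
      · obtain ⟨hiS, hia, hid⟩ := hS₄ i hi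
        have := (hbd i (hS i hiS)).2
        rw [hia, hid] at this
        exact Finset.mem_coe.2 (Finset.mem_range.2 this)
      · intro i hi j hj hij
        obtain ⟨hiS, hia, hid⟩ := hS₄ i hi
        obtain ⟨hjS, hja, hjd⟩ := hS₄ j hj
        have h1 := hst' i hiS j hjS hij
        have h2 := hall i hi
        have h3 := hall j hj
        simp only [StepType] at h1
        omega
  have hsum₁ : S₁.card + S₂.card = S.card := Finset.card_filter_add_card_filter_not _
  have hsum₂ : S₃.card + S₄.card = S₂.card := Finset.card_filter_add_card_filter_not _
  -- This gives a z + d f < k, so the truncated difference is genuine and the three bounds add up to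
  -- k.
  have := (hbd f (hS f hfS)).1
  omega

/-! ### The extremal family -/

/-- Used for the clique: where weights increase with the colour, a path never visiting a colour
below its first one is high. -/
theorem transGen_restrictRel_ge {V : Type*} {A : V → V → Prop} {col : V → ℕ}
    (hA : ∀ u v, A u v → col u < col v) {X : Set V} {u v : V}
    (h : TransGen (restrictRel A X) u v) :
    TransGen (restrictRel A {w | w ∈ X ∧ col u ≤ col w}) u v := by
  induction h with
  | single h => exact .single ⟨h.1, ⟨h.2.1, le_rfl⟩, ⟨h.2.2, (hA _ _ h.1).le⟩⟩
  | tail _ h ih =>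
    have hub := (lt_of_transGen hA (transGen_of_imp (fun _ _ hab => hab.1) ih)).le
    exact ih.tail ⟨h.1, ⟨h.2.1, hub⟩, ⟨h.2.2, hub.trans (hA _ _ h.1).le⟩⟩

/-- For every `k ≥ 1` there is a finite family of x-monotone curves through the `y`-axis whose
disjointness graph has clique number `k` and chromatic number `k (k + 1)² (k + 2) / 12`. -/
theorem exists_extremal_family (k : ℕ) (hk : 1 ≤ k) :
    ∃ F : Set (Set (ℝ × ℝ)), F.Finite ∧ (∀ C ∈ F, IsCurve C ∧ IsXMonotone C) ∧
      (∀ C ∈ F, (C ∩ verticalLine 0).Nonempty) ∧ (disjointnessGraph F).cliqueNum = k ∧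
      ∃ n : ℕ, (disjointnessGraph F).chromaticNumber = (n : ℕ∞) ∧
        12 * n = k * (k + 1) ^ 2 * (k + 2) := by
  classical
  obtain ⟨N, a, d, b, c, L, R, hN, hbd, hst, hdiag⟩ := exists_blocks k
  obtain ⟨V, hV, A, col, hcol, hA, hU, hχ, hp⟩ := exists_zykov N
  obtain ⟨M, ⟨e⟩⟩ := Finite.exists_equiv_fin V
  have hpair : ∀ u v, col u < col v → col u * M + e u < col v * M + e v := fun u v h =>
    mul_add_lt_mul_add h (e u).2
  -- Heights on the axis: the colour decides, and the index breaks ties.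
  have hg : Function.Injective fun v => ((col v * M + e v : ℕ) : ℝ) := by
    intro u v h
    have h : col u * M + e u = col v * M + e v := Nat.cast_injective (R := ℝ) h
    rcases lt_trichotomy (col u) (col v) with h' | h' | h'
    · exact absurd h (hpair u v h').ne
    · rw [h'] at h
      exact e.injective (Fin.ext (Nat.add_left_cancel h))
    · exact absurd h (hpair v u h').ne'
  obtain ⟨C, hC, hCc, hC0, hCd⟩ := exists_curves A _ hg
    (fun u v h => by exact_mod_cast hpair u v (hA u v h)) (L ∘ col) (R ∘ col)
  let φ : V ≃ Set.range C := Equiv.ofInjective C hC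
  have hfin : (Set.range C).Finite := Set.finite_range C
  have : Finite (Set.range C) := hfin
  let Dir : V → V → Prop := fun u v => HighPath A (L ∘ col) u v ∧ HighPath A (R ∘ col) u v
  have hDcol : ∀ {u v}, Dir u v → col u < col v := fun h => lt_of_transGen hA h.1.transGen
  have hadj : ∀ u v, (disjointnessGraph (Set.range C)).Adj (φ u) (φ v) ↔ Dir u v ∨ Dir v u := by
    intro u v
    rw [disjointnessGraph_adj]
    constructor
    · rintro ⟨hne, hd⟩
      exact (hCd u v fun h => hne (h ▸ rfl)).1 hd
    · intro h
      have hne : u ≠ v := by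
        rintro rfl
        rcases h with h | h <;> exact lt_irrefl _ (hDcol h)
      exact ⟨fun h' => hne (φ.injective h'), (hCd u v hne).2 h⟩
  have harc : ∀ u v, A u v → Dir u v := fun u v h =>
    ⟨.single ⟨h, min_le_left ((L ∘ col) u) _, min_le_right _ ((L ∘ col) v)⟩,
      .single ⟨h, min_le_left ((R ∘ col) u) _, min_le_right _ ((R ∘ col) v)⟩⟩
  have hvalley : ∀ (W : V → ℕ) {s t u}, TransGen A s t → TransGen A t u → HighPath A W s u →
      ¬ (W t < W s ∧ W t < W u) := by
    intro W s t u hst htu hsu h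
    have := hU _ s t u hst htu hsu
    exact (lt_min h.1 h.2).not_ge this
  refine ⟨Set.range C, hfin, ?_, ?_, le_antisymm ?_ ?_, N, ?_, hN⟩
  · rintro _ ⟨v, rfl⟩
    exact hCc v
  · rintro _ ⟨v, rfl⟩
    exact hC0 v
  · obtain ⟨s, hs⟩ := (disjointnessGraph (Set.range C)).exists_isNClique_cliqueNum
    have hsadj : ∀ x ∈ s, ∀ y ∈ s, x ≠ y → Dir (φ.symm x) (φ.symm y) ∨
        Dir (φ.symm y) (φ.symm x) := fun x hx y hy hne => by
      rw [← hadj, φ.apply_symm_apply, φ.apply_symm_apply]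
      exact hs.isClique hx hy hne
    have hDir : ∀ x ∈ s, ∀ y ∈ s, col (φ.symm x) < col (φ.symm y) →
        Dir (φ.symm x) (φ.symm y) := fun x hx y hy hxy => by
      rcases hsadj x hx y hy (by rintro rfl; exact lt_irrefl _ hxy) with h | h
      · exact h
      · exact absurd (hxy.trans (hDcol h)) (lt_irrefl _)
    have hcard : (s.image fun x => col (φ.symm x)).card = s.card := by
      refine Finset.card_image_of_injOn fun x hx y hy hxy => ?_
      have hxy : col (φ.symm x) = col (φ.symm y) := hxy
      by_contra hne
      rcases hsadj x hx y hy hne with h | h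
      · exact absurd hxy (hDcol h).ne
      · exact absurd hxy (hDcol h).ne'
    rw [← hs.card_eq, ← hcard]
    refine card_le_of_valleyFree hbd hst _ ?_ ?_ ?_
    · intro i hi
      obtain ⟨x, -, rfl⟩ := Finset.mem_image.1 hi
      exact hcol _
    all_goals
      intro i hi j hj l hl hij hjl
      obtain ⟨x, hx, rfl⟩ := Finset.mem_image.1 hi
      obtain ⟨y, hy, rfl⟩ := Finset.mem_image.1 hj
      obtain ⟨z, hz, rfl⟩ := Finset.mem_image.1 hl
      have hxy := (hDir x hx y hy hij).1.transGen
      have hyz := (hDir y hy z hz hjl).1.transGen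
      have hxz := hDir x hx z hz (hij.trans hjl)
    · exact hvalley (L ∘ col) hxy hyz hxz.1
    · exact hvalley (R ∘ col) hxy hyz hxz.2
  -- On the colours (t, 0, 0, 0) both weights increase, so a directed path confined to them is high
  -- on both sides.
  · let S : Finset ℕ := (Finset.range N).filter fun i => d i = 0 ∧ b i = 0 ∧ c i = 0
    have hSN : ∀ i ∈ S, i < N := fun i hi => Finset.mem_range.1 (Finset.mem_filter.1 hi).1
    have hmon : ∀ i ∈ S, ∀ j ∈ S, i ≤ j → L i ≤ L j ∧ R i ≤ R j := by
      intro i hi j hj hij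
      rcases hij.eq_or_lt with rfl | hij
      · exact ⟨le_rfl, le_rfl⟩
      · have h1 := (Finset.mem_filter.1 hi).2
        have h2 := (Finset.mem_filter.1 hj).2
        have h3 := hst i j hij (hSN j hj)
        simp only [StepType] at h3
        omega
    have hSk : k ≤ S.card := by
      rw [← Finset.card_range k]
      refine (Finset.card_le_card fun t ht => ?_).trans (Finset.card_image_le (s := S) (f := a))
      obtain ⟨i, hi, rfl, h⟩ := hdiag t (Finset.mem_range.1 ht)
      exact Finset.mem_image_of_mem _ (Finset.mem_filter.2 ⟨Finset.mem_range.2 hi, h⟩)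
    obtain ⟨p, hpc, hpt⟩ := hp S (Finset.card_pos.1 (by omega)) hSN
    have hclique : (disjointnessGraph (Set.range C)).IsClique (S.image fun i => φ (p i)) := by
      have hlt : ∀ i ∈ S, ∀ j ∈ S, i < j → Dir (p i) (p j) := by
        intro i hi j hj hij
        have h := transGen_restrictRel_ge hA (hpt i hi j hj hij)
        rw [hpc i hi] at h
        constructor
        · refine transGen_of_imp (fun _ _ hab => restrictRel_mono (fun w hw => ?_) hab) h
          refine (min_le_left ((L ∘ col) (p i)) _).trans ?_
          simp only [Function.comp, hpc i hi]
          exact (hmon i hi _ hw.1 hw.2).1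
        · refine transGen_of_imp (fun _ _ hab => restrictRel_mono (fun w hw => ?_) hab) h
          refine (min_le_left ((R ∘ col) (p i)) _).trans ?_
          simp only [Function.comp, hpc i hi]
          exact (hmon i hi _ hw.1 hw.2).2
      intro x hx y hy hne
      obtain ⟨i, hi, rfl⟩ := Finset.mem_image.1 (Finset.mem_coe.1 hx)
      obtain ⟨j, hj, rfl⟩ := Finset.mem_image.1 (Finset.mem_coe.1 hy)
      rw [hadj]
      rcases lt_trichotomy i j with h | rfl | h
      · exact .inl (hlt i hi j hj h)
      · exact absurd rfl hne
      · exact .inr (hlt j hj i hi h)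
    calc k ≤ S.card := hSk
      _ = (S.image fun i => φ (p i)).card := by
        refine (Finset.card_image_of_injOn fun i hi j hj hij => ?_).symm
        rw [← hpc i hi, ← hpc j hj, φ.injective hij]
      _ ≤ _ := hclique.card_le_cliqueNum
  · refine le_antisymm ?_ ?_
    · rw [SimpleGraph.chromaticNumber_le_iff_colorable]
      refine ⟨SimpleGraph.Coloring.mk (fun x => ⟨col (φ.symm x), hcol _⟩) ?_⟩
      intro x y hxy h
      have h : col (φ.symm x) = col (φ.symm y) := congrArg Fin.val h
      rw [← φ.apply_symm_apply x, ← φ.apply_symm_apply y, hadj] at hxy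
      rcases hxy with h' | h'
      · exact absurd h (hDcol h').ne
      · exact absurd h (hDcol h').ne'
    · refine SimpleGraph.le_chromaticNumber_iff_colorable.2 fun m hm => ?_
      obtain ⟨γ⟩ := hm
      have h1 := hχ (fun v => (γ (φ v) : ℕ)) fun u v h h' =>
        γ.valid ((hadj u v).2 (.inl (harc u v h))) (Fin.ext h')
      have h2 : (Set.range fun v => (γ (φ v) : ℕ)) ⊆ Set.Iio m := by
        rintro _ ⟨v, rfl⟩
        exact (γ (φ v)).2
      have h3 := Set.ncard_le_ncard h2 (Set.finite_Iio m)
      have h4 : (Set.Iio m).ncard = m := by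
        rw [← Finset.coe_range, Set.ncard_coe_finset, Finset.card_range]
      omega

theorem theorem4 :
    (∀ k : ℕ, 2 ≤ k →
      ∃ F : Set (Set (ℝ × ℝ)), F.Finite ∧
        (∀ C ∈ F, IsCurve C ∧ IsXMonotone C) ∧
        (∃ a : ℝ, ∀ C ∈ F, (C ∩ verticalLine a).Nonempty) ∧
        (disjointnessGraph F).cliqueNum = k ∧
        ∃ n : ℕ, (disjointnessGraph F).chromaticNumber = (n : ℕ∞) ∧
          (n : ℝ) = ((k : ℝ) + 1) / 2 * (Nat.choose (k + 2) 3 : ℝ)) ∧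
    (∃ c : ℝ, 0 < c ∧ ∀ k : ℕ, 2 ≤ k →
      ∃ F : Set (Set (ℝ × ℝ)), F.Finite ∧
        (∀ C ∈ F, IsCurve C ∧ IsXMonotone C) ∧
        (disjointnessGraph F).CliqueFree (k + 1) ∧
        ∀ m : ℕ, (disjointnessGraph F).Colorable m → c * (k : ℝ) ^ 4 ≤ (m : ℝ)) := by
  refine ⟨fun k hk => ?_, 1 / 12, by norm_num, fun k hk => ?_⟩
  · obtain ⟨F, hF, hFc, hF0, hω, n, hn, hn12⟩ := exists_extremal_family k (by omega)
    refine ⟨F, hF, hFc, ⟨0, hF0⟩, hω, n, hn, ?_⟩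
    have h1 : ((k + 2).choose 3) * 6 = (k + 2) * (k + 1) * k := by
      have h := Nat.descFactorial_eq_factorial_mul_choose (k + 2) 3
      simp [Nat.descFactorial, Nat.factorial] at h
      linarith
    have h1' : ((k + 2).choose 3 : ℝ) * 6 = (k + 2) * (k + 1) * k := by exact_mod_cast h1
    have h2 : (12 : ℝ) * n = k * (k + 1) ^ 2 * (k + 2) := by exact_mod_cast hn12
    linear_combination h2 / 12 - ((k : ℝ) + 1) / 12 * h1'
  · obtain ⟨F, hF, hFc, -, hω, n, hn, hn12⟩ := exists_extremal_family k (by omega)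
    refine ⟨F, hF, hFc, ?_, fun m hm => ?_⟩
    · intro s hs
      have : Finite F := hF
      have h := hs.isClique.card_le_cliqueNum
      rw [hω, hs.card_eq] at h
      omega
    · have h := hm.chromaticNumber_le
      rw [hn] at h
      have h1 : (n : ℝ) ≤ m := by exact_mod_cast h
      have h2 : (12 : ℝ) * n = k * (k + 1) ^ 2 * (k + 2) := by exact_mod_cast hn12
      have h3 : (k : ℝ) ^ 4 ≤ k * (k + 1) ^ 2 * (k + 2) := by
        calc (k : ℝ) ^ 4 = k * k ^ 2 * k := by ring
          _ ≤ _ := by gcongr <;> linarith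
      linarith
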